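/- **Setting.** Let $\mathbb{A}$ be a set of records, $\mathbb{X}$ a family of finite subsets of $\mathbb{A}$ (datasets), and $\mathbb{Y}$ a family of finite multisets of elements of $\mathbb{A}$ (batches). Fix a batch size $q \in \mathbb{N}_0$, and assume that $\mathbb{Y}$ contains every multiset $y$ with $|y| = q$ all of whose elements lie in some $x \in \mathbb{X}$. Let $\xi_y(a)$ be the multiplicity of $a$ in $y$. Datasets are related by substitution, $x \simeq_{\Delta,\mathbb{X}} x'$, if $x' = (x \setminus \{a\}) \cup \{a'\}$ with $a \in x$, $a' \notin x$; batches are related by substitution, $y \simeq_{\Delta,\mathbb{Y}} y'$, if $y'$ arises from $y$ by replacing one occurrence of some element by one occurrence of some element of $\mathbb{A}$. Let $h : \mathbb{Y} \to \mathbb{R}^D$, let $\sigma > 0$, and let $b_y$ be the density of $h(y) + V$ with $V \sim \mathcal{N}(\mathbf{0}, \sigma^2 \mathbf{I}_D)$ (the Gaussian mechanism). Let $L_2 = \sup\{\|h(y) - h(y')\|_2 : y, y' \in \mathbb{Y},\ y \simeq_{\Delta,\mathbb{Y}} y'\}$ be its $\ell_2$-sensitivity and assume $0 < L_2 < \infty$.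 For a subsampling scheme that draws from $x$ a batch $y$ of size $q$ with probability $s_x(y)$, the subsampled mechanism has density $m_x = \sum_y s_x(y)\, b_y$. For densities $p, r$ and $\alpha \ge 0$ let $H_\alpha(p \,\|\, r) = \int \max\{p(z)/r(z) - \alpha,\, 0\}\, r(z)\,\mathrm{d}z$ be the hockey-stick divergence. **Theorem.** Let $N \in \mathbb{N}$ and let $x \simeq_{\Delta,\mathbb{X}} x'$ be datasets in $\mathbb{X}$ of size $N$. (If $N = 1$, assume also that $\mathbb{Y}$ contains every multiset of size $q$ of elements of $x \cup x'$.) Then, for every $\alpha \ge 0$, $$H_\alpha(m_x \,\|\, m_{x'}) \;\le\; H_\alpha\Big( \sum_{i=1}^{q+1} w_i\, f^{(1)}_i \;\Big\|\; \sum_{j=1}^{q+1} w_j\, f^{(2)}_j \Big),$$ where $f^{(1)}_i$ and $f^{(2)}_j$ are the univariate normal densities with means $i-1$ and $-(j-1)$, respectively, and standard deviation $\sigma / L_2$, and where $w_i$ is the probability that a fixed record of a dataset of size $N$ occurs exactly $i-1$ times in the batch. This holds for each of the following two forms of subsampling with replacement: 1. the batch consists of $q$ independent uniform draws from $x$, that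 is, $s_x(y) = \dfrac{q!}{\prod_a \xi_y(a)!}\, N^{-q}$, with weights $$w_i = \binom{q}{i-1} \Big(\frac1N\Big)^{i-1} \Big(1 - \frac1N\Big)^{q-(i-1)} ;$$ 2. the batch is uniformly distributed over all multisets of size $q$ of elements of $x$, that is, $s_x(y) = \binom{N+q-1}{q}^{-1}$, with weights $$w_i = \left(\!\!\binom{N-1}{q-(i-1)}\!\!\right) \Big/ \left(\!\!\binom{N}{q}\!\!\right),$$ where $\left(\!\binom{n}{k}\!\right)$ is the number of multisets of size $k$ of elements of an $n$-element set. In particular, the pair of mixtures on the right-hand side does not depend on $\alpha$, $x$, $x'$, and is therefore a dominating pair for the subsampled mechanism under substitution of one record in datasets of size $N$. -/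

import Mathlib

open MeasureTheory

noncomputable section

/-- Hockey-stick divergence `H_α(p ‖ q) = ∫ max {p z / q z - α, 0} * q z dz` of two densities with
respect to Lebesgue measure. The integrand is nonnegative when `q` is, and the integral is taken
in `[0, ∞]`. -/
def hockeyStick {E : Type*} [MeasureSpace E] (α : ℝ) (p q : E → ℝ) : ENNReal :=
  ∫⁻ z, ENNReal.ofReal (max (p z / q z - α) 0 * q z)

/-- Lebesgue density of the normal distribution `N(μ, σ² I_D)` on `ℝ^D`. -/
def gaussianDensity {D : ℕ} (μ : EuclideanSpace ℝ (Fin D)) (σ : ℝ) (z : EuclideanSpace ℝ (Fin D)) :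
    ℝ :=
  (Real.sqrt (2 * Real.pi * σ ^ 2))⁻¹ ^ D * Real.exp (-‖z - μ‖ ^ 2 / (2 * σ ^ 2))

/-- Lebesgue density of the univariate normal distribution with mean `μ` and standard
deviation `s`. -/
def normalDensity (μ s : ℝ) (z : ℝ) : ℝ :=
  ProbabilityTheory.gaussianPDFReal μ (s.toNNReal ^ 2) z

/-- Substitution relation on datasets (finite sets of records): `x' = x \ {a} ∪ {a'}` for some
record `a ∈ x` and some new record `a' ∉ x`. -/
def DatasetSubst {A : Type*} [DecidableEq A] (x x' : Finset A) : Prop :=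
  ∃ a ∈ x, ∃ a' ∉ x, x' = insert a' (x.erase a)

/-- Substitution relation on batches (multisets of records): one occurrence of some `a` in `y` is
replaced by one occurrence of some `a'`. -/
def BatchSubst {A : Type*} [DecidableEq A] (y y' : Multiset A) : Prop :=
  ∃ a ∈ y, ∃ a', y' = a' ::ₘ y.erase a

/-- All distances `‖h y - h y'‖₂` between batches `y, y'` of the batch space `Y` that are related
by substitution. -/
def substGaps {A : Type*} [DecidableEq A] {D : ℕ} (Y : Set (Multiset A))
    (h : Multiset A → EuclideanSpace ℝ (Fin D)) : Set ℝ :=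
  {r | ∃ y ∈ Y, ∃ y' ∈ Y, BatchSubst y y' ∧ r = ‖h y - h y'‖}

/-- The `ℓ₂`-sensitivity of `h` under the substitution relation on the batch space `Y`. -/
def l2Sensitivity {A : Type*} [DecidableEq A] {D : ℕ} (Y : Set (Multiset A))
    (h : Multiset A → EuclideanSpace ℝ (Fin D)) : ℝ :=
  sSup (substGaps Y h)

/-- Batch probabilities when the batch consists of `q` independent uniform draws from `x`: there are
`y.countPerms = q! / ∏ a, (y.count a)!` sequences of draws that produce the multiset `y`, and each
of them has probability `1 / |x| ^ q`. -/
def iidPMF {A : Type*} [DecidableEq A] (q : ℕ) (x : Finset A) (y : Multiset A) : ℝ :=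
  if Multiset.card y = q ∧ ∀ b ∈ y, b ∈ x then (y.countPerms : ℝ) / (x.card : ℝ) ^ q else 0

/-- Batch probabilities when the batch is uniformly distributed over the
`Nat.multichoose |x| q = (|x| + q - 1).choose q` multisets of size `q` of elements of `x`. -/
def uniformMultisetPMF {A : Type*} [DecidableEq A] (q : ℕ) (x : Finset A) (y : Multiset A) : ℝ :=
  if Multiset.card y = q ∧ ∀ b ∈ y, b ∈ x then ((x.card.multichoose q : ℕ) : ℝ)⁻¹ else 0

/-- Density `m_x` of the subsampled Gaussian mechanism `M = B ∘ S` on the dataset `x`: the mixture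
of the densities of `B(y) = h(y) + N(0, σ² I_D)` over all batches `y` of size `q` of elements of
`x`, weighted with the batch probabilities `s x y` of the scheme `S`. -/
def subsampledDensity {A : Type*} [DecidableEq A] {D : ℕ} (q : ℕ)
    (s : Finset A → Multiset A → ℝ) (h : Multiset A → EuclideanSpace ℝ (Fin D)) (σ : ℝ)
    (x : Finset A) (z : EuclideanSpace ℝ (Fin D)) : ℝ :=
  ∑ y ∈ x.sym q, s x (y : Multiset A) * gaussianDensity (h (y : Multiset A)) σ z

/-- The univariate mixture `∑_{i=0}^q w_i N(c * i, s²)`, with standard deviation `s`. -/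
def gaussianMixture (q : ℕ) (w : ℕ → ℝ) (c s : ℝ) (z : ℝ) : ℝ :=
  ∑ i ∈ Finset.range (q + 1), w i * normalDensity (c * i) s z

/-- Probability that a fixed record of a dataset of size `N` is drawn exactly `i` times in `q`
independent uniform draws. -/
def iidWeight (N q i : ℕ) : ℝ :=
  (q.choose i : ℝ) * (1 / (N : ℝ)) ^ i * (1 - 1 / (N : ℝ)) ^ (q - i)

/-- Probability that a fixed record of a dataset of size `N` has multiplicity exactly `i` in a
uniformly random multiset of size `q`. -/
def uniformMultisetWeight (N q i : ℕ) : ℝ :=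
  ((N - 1).multichoose (q - i) : ℝ) / (N.multichoose q : ℝ)

end

/-! Write `x = x₀ ∪ {a}` and `x' = x₀ ∪ {a'}`. Given that `a` occurs `i` times, the rest of the
batch is drawn by the same scheme from `x₀` with size `q - i`; the same holds for `a'`, with the
same weights. For nonempty `x₀`, these remainders are coupled as a nested sequence `z 0 ⊇ z 1 ⊇ …`,
each one record smaller than the one before (`exists_nested_coupling`). Passing from `z i + i·a` to
`z (i+1) + (i+1)·a` is one substitution, so its image under `h` lies within `i * L₂` of `h (z 0)`,
and likewise for `a'`. Joint convexity of the hockey-stick divergence then reduces the claim to one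
outcome of the coupling (`hockeyStick_le_of_coupling`).

What remains is a Gaussian comparison (`lintegral_signed_gaussianDensity_le`). In a signed mixture
`∑ c i N(u i)`, the mass of the positive part does not decrease when every `c i * c j * ⟪u i, u j⟫`
is raised, in units of the variance, to the value of a collinear configuration `r` whose signs agree
with `c`. By Cauchy–Schwarz, the means `i` and `-i` form such a configuration. The proof moves the
means `(a • u i, b * r i)` in `ℝ^D × ℝ` from `b = 0` to `a = 0`. At each step the optimal test for
the old mixture does at least as well on the new one. -/

/-! ### Moving the components of a signed mixture. -/

/-- After a change of variables, the `i`-th term integrates `g` over the positivity set of the first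
mixture, translated by `m i` or by `m' i`. By `hpos` and `hneg`, replacing `m i` by `m' i` enlarges
that set when `c i > 0` and shrinks it when `c i < 0`, so no term decreases. -/
theorem lintegral_ofReal_sum_translate_le {G ι : Type*} [AddCommGroup G] [MeasurableSpace G]
    [MeasurableAdd₂ G] [MeasurableNeg G] [Fintype ι] {μ : Measure G} [μ.IsAddRightInvariant]
    (c : ι → ℝ) (m m' : ι → G) (g : G → ℝ) (hg : ∀ z, 0 ≤ g z) (hgm : Measurable g)
    (hgi : Integrable g μ)
    (hpos : ∀ i z, 0 < c i → 0 < ∑ j, c j * g (z + m i - m j) →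
      0 < ∑ j, c j * g (z + m' i - m j))
    (hneg : ∀ i z, c i < 0 → 0 < ∑ j, c j * g (z + m' i - m j) →
      0 < ∑ j, c j * g (z + m i - m j)) :
    ∫⁻ z, ENNReal.ofReal (∑ i, c i * g (z - m i)) ∂μ ≤
      ∫⁻ z, ENNReal.ofReal (∑ i, c i * g (z - m' i)) ∂μ := by
  have : MeasurableSub₂ G := ⟨by simpa only [sub_eq_add_neg] using! by fun_prop⟩
  set S : G → ℝ := fun z => ∑ j, c j * g (z - m j) with hS
  set S' : G → ℝ := fun z => ∑ j, c j * g (z - m' j) with hS'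
  have hSm : Measurable S := by fun_prop
  have hint : ∀ v : G, Integrable (fun z => g (z - v)) μ := fun v => hgi.comp_sub_right v
  have hSi : Integrable S μ := integrable_finsetSum _ fun i _ => (hint _).const_mul _
  have hSi' : Integrable S' μ := integrable_finsetSum _ fun i _ => (hint _).const_mul _
  -- The optimal test for `S`; for `S'` it is merely admissible, which is enough for a lower bound.
  set χ : G → ℝ := {z | 0 < S z}.indicator 1 with hχ
  have hA : MeasurableSet {z | 0 < S z} := measurableSet_lt measurable_const hSm
  have hχm : Measurable χ := measurable_one.indicator hA
  have hχ0 : ∀ z, 0 ≤ χ z := fun z => Set.indicator_nonneg (fun _ _ => zero_le_one) z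
  have hχ1 : ∀ z, χ z ≤ 1 := fun z => Set.indicator_le_self' (fun _ _ => zero_le_one) z
  have hmul : ∀ (f k : G → ℝ), Measurable k → (∀ z, 0 ≤ k z) → (∀ z, k z ≤ 1) →
      Integrable f μ → Integrable (fun z => k z * f z) μ := fun f k hk h0 h1 hf =>
    hf.bdd_mul (c := 1) hk.aestronglyMeasurable
      (Filter.Eventually.of_forall fun z => by rw [Real.norm_of_nonneg (h0 z)]; exact h1 z)
  have key : ∀ v : ι → G, ∫ z, χ z * ∑ i, c i * g (z - v i) ∂μ =
      ∑ i, c i * ∫ z, χ (z + v i) * g z ∂μ := by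
    intro v
    simp_rw [Finset.mul_sum]
    rw [integral_finsetSum]
    · refine Finset.sum_congr rfl fun i _ => ?_
      rw [← integral_const_mul,
        ← integral_sub_right_eq_self (fun z => c i * (χ (z + v i) * g z)) (v i)]
      refine integral_congr_ae (Filter.Eventually.of_forall fun z => ?_)
      simp only [sub_add_cancel]
      ring
    · intro i _
      exact hmul _ _ hχm hχ0 hχ1 ((hint _).const_mul _)
  have hmono : ∀ a b : G → ℝ, (∀ z, (0 < a z → 0 < b z)) → ∀ z,
      ({z | 0 < a z}.indicator 1 z : ℝ) ≤ {z | 0 < b z}.indicator 1 z := by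
    intro a b hab z
    exact Set.indicator_le_indicator_of_subset (fun z hz => hab z hz) (fun _ => zero_le_one) z
  have hle : ∑ i, c i * ∫ z, χ (z + m i) * g z ∂μ ≤ ∑ i, c i * ∫ z, χ (z + m' i) * g z ∂μ := by
    have hi : ∀ v : G, Integrable (fun z => χ (z + v) * g z) μ := fun v =>
      hmul _ _ (by fun_prop) (fun _ => hχ0 _) (fun _ => hχ1 _) hgi
    refine Finset.sum_le_sum fun i _ => ?_
    rcases lt_trichotomy (c i) 0 with h | h | h
    · refine mul_le_mul_of_nonpos_left (integral_mono (hi _) (hi _) fun z => ?_) h.le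
      refine mul_le_mul_of_nonneg_right ?_ (hg z)
      exact hmono (fun z => S (z + m' i)) (fun z => S (z + m i)) (fun z => hneg i z h) z
    · simp [h]
    · refine mul_le_mul_of_nonneg_left (integral_mono (hi _) (hi _) fun z => ?_) h.le
      refine mul_le_mul_of_nonneg_right ?_ (hg z)
      exact hmono (fun z => S (z + m i)) (fun z => S (z + m' i)) (fun z => hpos i z h) z
  have h1 : ∀ z, max (S z) 0 = χ z * S z := by
    intro z
    by_cases hz : 0 < S z
    · simp [hχ, hz, hz.le]
    · simp [hχ, hz, not_lt.1 hz]
  have h2 : ∀ z, χ z * S' z ≤ max (S' z) 0 := by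
    intro z
    by_cases hz : 0 < S z
    · simp [hχ, hz]
    · simp [hχ, hz]
  have hfin : ∫ z, max (S z) 0 ∂μ ≤ ∫ z, max (S' z) 0 ∂μ := by
    calc ∫ z, max (S z) 0 ∂μ = ∫ z, χ z * S z ∂μ := by simp_rw [h1]
      _ = _ := key m
      _ ≤ _ := hle
      _ = _ := (key m').symm
      _ ≤ _ := integral_mono (hmul _ _ hχm hχ0 hχ1 hSi') hSi'.pos_part h2
  have h3 : ∀ f : G → ℝ, Integrable f μ →
      ∫⁻ z, ENNReal.ofReal (f z) ∂μ = ENNReal.ofReal (∫ z, max (f z) 0 ∂μ) := by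
    intro f hf
    rw [ofReal_integral_eq_lintegral_ofReal hf.pos_part
      (Filter.Eventually.of_forall fun z => le_max_right _ _)]
    refine lintegral_congr fun z => ?_
    rcases le_total (f z) 0 with h | h
    · simp [h, ENNReal.ofReal_of_nonpos]
    · simp [h]
  rw [h3 _ hSi, h3 _ hSi']
  exact ENNReal.ofReal_le_ofReal hfin

/-! ### Gaussian densities. -/

theorem gaussianDensity_pos {D : ℕ} (u : EuclideanSpace ℝ (Fin D)) {σ : ℝ} (hσ : 0 < σ)
    (z : EuclideanSpace ℝ (Fin D)) : 0 < gaussianDensity u σ z := by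
  unfold gaussianDensity; positivity

theorem continuous_gaussianDensity {D : ℕ} (σ : ℝ) :
    Continuous fun p : EuclideanSpace ℝ (Fin D) × EuclideanSpace ℝ (Fin D) =>
      gaussianDensity p.1 σ p.2 := by
  unfold gaussianDensity; fun_prop

theorem gaussianDensity_sub {D : ℕ} (u : EuclideanSpace ℝ (Fin D)) (σ : ℝ)
    (z : EuclideanSpace ℝ (Fin D)) : gaussianDensity 0 σ (z - u) = gaussianDensity u σ z := by
  simp [gaussianDensity]

theorem integral_gaussianDensity {D : ℕ} {σ : ℝ} (hσ : 0 < σ) :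
    ∫ z, gaussianDensity (0 : EuclideanSpace ℝ (Fin D)) σ z = 1 := by
  unfold gaussianDensity
  have h := GaussianFourier.integral_rexp_neg_mul_sq_norm (V := EuclideanSpace ℝ (Fin D))
    (b := 1 / (2 * σ ^ 2)) (by positivity)
  rw [integral_const_mul]
  have h' : ∀ z : EuclideanSpace ℝ (Fin D),
      -‖z - 0‖ ^ 2 / (2 * σ ^ 2) = -(1 / (2 * σ ^ 2)) * ‖z‖ ^ 2 := by
    intro z; rw [sub_zero]; ring
  simp_rw [h', h]
  have h2 : Real.pi / (1 / (2 * σ ^ 2)) = 2 * Real.pi * σ ^ 2 := by field_simp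
  rw [h2, finrank_euclideanSpace, Fintype.card_fin, Real.sqrt_eq_rpow, inv_pow,
    ← Real.rpow_mul_natCast (by positivity), show (1 / 2 * (D : ℝ)) = D / 2 by ring]
  exact inv_mul_cancel₀ (by positivity)

theorem normalDensity_eq {r s : ℝ} (hs : 0 < s) (t : ℝ) :
    normalDensity r s t = (Real.sqrt (2 * Real.pi * s ^ 2))⁻¹ *
      Real.exp (-(t - r) ^ 2 / (2 * s ^ 2)) := by
  simp [normalDensity, ProbabilityTheory.gaussianPDFReal, Real.coe_toNNReal _ hs.le]

theorem normalDensity_pos (r : ℝ) {s : ℝ} (hs : 0 < s) (t : ℝ) : 0 < normalDensity r s t := by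
  rw [normalDensity_eq hs]; positivity

theorem normalDensity_sub {s : ℝ} (hs : 0 < s) (r t : ℝ) :
    normalDensity 0 s (t - r) = normalDensity r s t := by
  simp [normalDensity_eq hs]

theorem measurable_normalDensity (r s : ℝ) : Measurable (normalDensity r s) :=
  ProbabilityTheory.measurable_gaussianPDFReal _ _

theorem integral_normalDensity (r : ℝ) {s : ℝ} (hs : 0 < s) : ∫ t, normalDensity r s t = 1 :=
  ProbabilityTheory.integral_gaussianPDFReal_eq_one r (by
    have := Real.toNNReal_pos.2 hs
    positivity)

/-! ### Displacing the means of Gaussians on `ℝ^D × ℝ`. -/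

section ProductGaussian

variable {D : ℕ} {ι : Type*} [Fintype ι]

/-- The density of a product of a centred Gaussian on `ℝ^D` and a centred Gaussian on `ℝ`. -/
noncomputable def prodGaussian (D : ℕ) (σ s : ℝ) (p : EuclideanSpace ℝ (Fin D) × ℝ) : ℝ :=
  gaussianDensity 0 σ p.1 * normalDensity 0 s p.2

theorem prodGaussian_pos {σ s : ℝ} (hσ : 0 < σ) (hs : 0 < s) (p : EuclideanSpace ℝ (Fin D) × ℝ) :
    0 < prodGaussian D σ s p :=
  mul_pos (gaussianDensity_pos _ hσ _) (normalDensity_pos _ hs _)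

theorem measurable_prodGaussian (σ s : ℝ) : Measurable (prodGaussian D σ s) := by
  unfold prodGaussian
  have h1 : Measurable fun z : EuclideanSpace ℝ (Fin D) => gaussianDensity 0 σ z :=
    ((continuous_gaussianDensity σ).comp (Continuous.prodMk_right 0)).measurable
  exact (h1.comp measurable_fst).mul ((measurable_normalDensity _ _).comp measurable_snd)

theorem integrable_prodGaussian {σ s : ℝ} (hσ : 0 < σ) (hs : 0 < s) :
    Integrable (prodGaussian D σ s) (volume.prod volume) :=
  (integrable_of_integral_eq_one (integral_gaussianDensity hσ)).mul_prod
    (integrable_of_integral_eq_one (integral_normalDensity 0 hs))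

theorem prodGaussian_add_sub {σ s : ℝ} (hσ : 0 < σ) (hs : 0 < s)
    (p v m : EuclideanSpace ℝ (Fin D) × ℝ) :
    prodGaussian D σ s (p + v - m) = prodGaussian D σ s (p + v) *
      Real.exp ((inner ℝ p.1 m.1 / σ ^ 2 + p.2 * m.2 / s ^ 2
        - ‖m.1‖ ^ 2 / (2 * σ ^ 2) - m.2 ^ 2 / (2 * s ^ 2))
        + (inner ℝ v.1 m.1 / σ ^ 2 + v.2 * m.2 / s ^ 2)) := by
  unfold prodGaussian gaussianDensity
  rw [normalDensity_eq hs, normalDensity_eq hs]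
  have h : ∀ a b e1 e2 f1 f2 k : ℝ, e1 + e2 = f1 + f2 + k →
      a * Real.exp e1 * (b * Real.exp e2) = a * Real.exp f1 * (b * Real.exp f2) * Real.exp k := by
    intro a b e1 e2 f1 f2 k hk
    have := congrArg Real.exp hk
    rw [Real.exp_add, Real.exp_add, Real.exp_add] at this
    linear_combination a * b * this
  refine h _ _ _ _ _ _ _ ?_
  simp only [Prod.fst_sub, Prod.fst_add, Prod.snd_sub, Prod.snd_add, sub_zero]
  rw [norm_sub_sq_real, inner_add_left]
  field_simp
  ring

/-- Signed comparison of Gaussian mixtures under a small displacement of the means. -/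
theorem lintegral_prodGaussian_step {σ s : ℝ} (hσ : 0 < σ) (hs : 0 < s) (c : ι → ℝ)
    (m m' : ι → EuclideanSpace ℝ (Fin D) × ℝ)
    (h : ∀ i j, 0 ≤ c i * c j * (inner ℝ ((m' i).1 - (m i).1) (m j).1 / σ ^ 2
      + ((m' i).2 - (m i).2) * (m j).2 / s ^ 2)) :
    ∫⁻ z, ENNReal.ofReal (∑ i, c i * prodGaussian D σ s (z - m i)) ∂(volume.prod volume) ≤
      ∫⁻ z, ENNReal.ofReal (∑ i, c i * prodGaussian D σ s (z - m' i)) ∂(volume.prod volume) := by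
  -- The common positive factor `prodGaussian (z + v)` drops out of the sign. What remains depends
  -- on `v` only through its scaled inner products with the means, so each summand is monotone in
  -- them.
  have hfac : ∀ z v, 0 < ∑ j, c j * prodGaussian D σ s (z + v - m j) ↔
      0 < ∑ j, c j * Real.exp ((inner ℝ z.1 (m j).1 / σ ^ 2 + z.2 * (m j).2 / s ^ 2
        - ‖(m j).1‖ ^ 2 / (2 * σ ^ 2) - (m j).2 ^ 2 / (2 * s ^ 2))
        + (inner ℝ v.1 (m j).1 / σ ^ 2 + v.2 * (m j).2 / s ^ 2)) := by
    intro z v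
    simp_rw [prodGaussian_add_sub hσ hs, mul_left_comm (c _), ← Finset.mul_sum]
    exact mul_pos_iff_of_pos_left (prodGaussian_pos hσ hs _)
  have hdiff : ∀ i j, inner ℝ ((m' i).1 - (m i).1) (m j).1 / σ ^ 2
      + ((m' i).2 - (m i).2) * (m j).2 / s ^ 2 =
      (inner ℝ (m' i).1 (m j).1 / σ ^ 2 + (m' i).2 * (m j).2 / s ^ 2) -
      (inner ℝ (m i).1 (m j).1 / σ ^ 2 + (m i).2 * (m j).2 / s ^ 2) := by
    intro i j
    rw [inner_sub_left]; ring
  refine lintegral_ofReal_sum_translate_le c m m' _ (fun z => (prodGaussian_pos hσ hs z).le)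
    (measurable_prodGaussian σ s) (integrable_prodGaussian hσ hs) ?_ ?_
  · intro i z hi hz
    rw [hfac] at hz ⊢
    refine hz.trans_le (Finset.sum_le_sum fun j _ => ?_)
    have hij := h i j
    rw [hdiff, mul_assoc] at hij
    have hij := nonneg_of_mul_nonneg_right hij hi
    rcases lt_trichotomy (c j) 0 with hj | hj | hj
    · have := nonpos_of_mul_nonneg_right hij hj
      exact mul_le_mul_of_nonpos_left (Real.exp_le_exp.2 (by linarith)) hj.le
    · simp [hj]
    · have := nonneg_of_mul_nonneg_right hij hj
      exact mul_le_mul_of_nonneg_left (Real.exp_le_exp.2 (by linarith)) hj.le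
  · intro i z hi hz
    rw [hfac] at hz ⊢
    refine hz.trans_le (Finset.sum_le_sum fun j _ => ?_)
    have hij := h i j
    rw [hdiff, mul_assoc] at hij
    have hij := nonpos_of_mul_nonneg_right hij hi
    rcases lt_trichotomy (c j) 0 with hj | hj | hj
    · have := nonneg_of_mul_nonpos_right hij hj
      exact mul_le_mul_of_nonpos_left (Real.exp_le_exp.2 (by linarith)) hj.le
    · simp [hj]
    · have := nonpos_of_mul_nonpos_right hij hj
      exact mul_le_mul_of_nonneg_left (Real.exp_le_exp.2 (by linarith)) hj.le

end ProductGaussian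

/-! ### A discrete path from `(ρ, 0)` to `(0, 1)`. -/

/-- The step condition discretizes `-a da ≤ b db`, whose extremal paths are circles. Discrete steps
gain radius to second order, so starting at `ρ < 1` leaves room for the total gain. -/
theorem le_of_forall_small_steps {Φ : ℝ → ℝ → ENNReal}
    (hstep : ∀ a a' b b', 0 ≤ a' → a' ≤ a → 0 ≤ b → b ≤ b' → a * (a - a') ≤ b * (b' - b) →
      Φ a b ≤ Φ a' b') {ρ : ℝ} (h0 : 0 ≤ ρ) (h1 : ρ < 1) : Φ ρ 0 ≤ Φ 0 1 := by
  have hρ : 0 < (1 - ρ ^ 2) / 2 := by nlinarith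
  -- Half of the slack `1 - ρ ^ 2` pays for lifting `b` off zero, where `a` could not move; the
  -- other half pays for the discretization error.
  set δ := Real.sqrt ((1 - ρ ^ 2) / 2) with hδ
  have hδ0 : 0 < δ := Real.sqrt_pos.2 hρ
  have hδ2 : δ ^ 2 = (1 - ρ ^ 2) / 2 := Real.sq_sqrt hρ.le
  -- A step of length `ε` raises `a ^ 2 + b ^ 2` by `ε ^ 2 * (1 + u ^ 2 / v ^ 2) ≤ ε ^ 2 * K`; with
  -- `ε = ρ / n`, the `n` steps add at most `ρ ^ 2 * K / n`.
  set K := 1 + ρ ^ 2 / δ ^ 2 with hK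
  obtain ⟨n, hn⟩ := exists_nat_gt (ρ ^ 2 * K / ((1 - ρ ^ 2) / 2))
  have hK0 : 0 < K := by positivity
  have hn0 : (0 : ℝ) < n := lt_of_le_of_lt (by positivity) hn
  rw [div_lt_iff₀ hρ] at hn
  set ε := ρ / n with hε
  have hεn : n * ε = ρ := by rw [hε]; field_simp
  have hε0 : 0 ≤ ε := by positivity
  have main : ∀ k : ℕ, k ≤ n → ∃ v, δ ≤ v ∧
      (ρ - k * ε) ^ 2 + v ^ 2 ≤ ρ ^ 2 + δ ^ 2 + k * (ε ^ 2 * K) ∧ Φ ρ 0 ≤ Φ (ρ - k * ε) v := by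
    intro k
    induction k with
    | zero =>
      intro _
      refine ⟨δ, le_rfl, by simp, ?_⟩
      simpa using hstep ρ ρ 0 δ h0 le_rfl le_rfl hδ0.le (by simp)
    | succ k ih =>
      intro hk
      obtain ⟨v, hv, hsq, hΦ⟩ := ih (by omega)
      have hkn : ((k + 1 : ℕ) : ℝ) ≤ n := by exact_mod_cast hk
      push_cast at hkn ⊢
      have hu' : 0 ≤ ρ - (k + 1) * ε := by nlinarith
      have hu : 0 ≤ ρ - k * ε := by nlinarith
      have huρ : ρ - k * ε ≤ ρ := by
        have : 0 ≤ (k : ℝ) * ε := by positivity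
        linarith
      set u := ρ - k * ε with hu_def
      have hv0 : 0 < v := hδ0.trans_le hv
      have e1 : ρ - (k + 1) * ε = u - ε := by rw [hu_def]; ring
      rw [e1] at hu' ⊢
      have hinc : 0 ≤ u * ε / v := by positivity
      -- This increment gives equality in the term `u * ε = v * (v' - v)` of the step condition.
      refine ⟨v + u * ε / v, by linarith, ?_, hΦ.trans (hstep _ _ _ _ hu' (by linarith)
        hv0.le (by linarith) ?_)⟩
      · have e2 : (v + u * ε / v) ^ 2 = v ^ 2 + 2 * (u * ε) + ε ^ 2 * (u ^ 2 / v ^ 2) := by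
          field_simp
          ring
        have e3 : u ^ 2 / v ^ 2 ≤ ρ ^ 2 / δ ^ 2 := by gcongr
        have e4 : ε ^ 2 * (u ^ 2 / v ^ 2) ≤ ε ^ 2 * (ρ ^ 2 / δ ^ 2) := by gcongr
        rw [e2, hK]
        rw [hK] at hsq
        nlinarith
      · have : v * (v + u * ε / v - v) = u * ε := by field_simp; ring
        rw [this]
        nlinarith
  obtain ⟨v, hv, hsq, hΦ⟩ := main n le_rfl
  rw [hεn, sub_self] at hsq hΦ
  have e5 : n * (ε ^ 2 * K) ≤ (1 - ρ ^ 2) / 2 := by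
    have : n * (ε ^ 2 * K) = ρ ^ 2 * K / n := by rw [hε]; field_simp
    rw [this, div_le_iff₀ hn0]
    linarith
  have hv1 : v ≤ 1 := by nlinarith
  -- At `a = 0` the second coordinate may increase freely up to `1`.
  exact hΦ.trans (hstep _ _ _ _ le_rfl le_rfl (hδ0.le.trans hv) hv1
    (by rw [zero_mul]; exact mul_nonneg (hδ0.le.trans hv) (by linarith)))

/-! ### Comparison with collinear means. -/

theorem lintegral_ofReal_gaussianDensity {D : ℕ} {σ : ℝ} (hσ : 0 < σ) :
    ∫⁻ z, ENNReal.ofReal (gaussianDensity (0 : EuclideanSpace ℝ (Fin D)) σ z) = 1 := by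
  rw [← ofReal_integral_eq_lintegral_ofReal
    (integrable_of_integral_eq_one (integral_gaussianDensity hσ))
    (Filter.Eventually.of_forall fun z => (gaussianDensity_pos _ hσ _).le),
    integral_gaussianDensity hσ, ENNReal.ofReal_one]

theorem lintegral_ofReal_normalDensity {s : ℝ} (hs : 0 < s) :
    ∫⁻ t, ENNReal.ofReal (normalDensity 0 s t) = 1 := by
  rw [← ofReal_integral_eq_lintegral_ofReal
    (integrable_of_integral_eq_one (integral_normalDensity 0 hs))
    (Filter.Eventually.of_forall fun z => (normalDensity_pos _ hs _).le),
    integral_normalDensity 0 hs, ENNReal.ofReal_one]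

theorem measurable_gaussianDensity {D : ℕ} (u : EuclideanSpace ℝ (Fin D)) (σ : ℝ) :
    Measurable (gaussianDensity u σ) :=
  ((continuous_gaussianDensity σ).comp (Continuous.prodMk_right u)).measurable

theorem lintegral_ofReal_prod_mul {β γ : Type*} [MeasurableSpace β] [MeasurableSpace γ]
    {μ : Measure β} {ν : Measure γ} [SFinite ν] {f : β → ℝ} {g : γ → ℝ} (hf : Measurable f)
    (hg : Measurable g) (h : (∀ z, 0 ≤ f z) ∨ ∀ t, 0 ≤ g t) :
    ∫⁻ p, ENNReal.ofReal (f p.1 * g p.2) ∂(μ.prod ν) =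
      (∫⁻ z, ENNReal.ofReal (f z) ∂μ) * ∫⁻ t, ENNReal.ofReal (g t) ∂ν := by
  rw [← lintegral_prod_mul hf.ennreal_ofReal.aemeasurable hg.ennreal_ofReal.aemeasurable]
  refine lintegral_congr fun p => ?_
  rcases h with h | h
  · exact ENNReal.ofReal_mul (h _)
  · exact ENNReal.ofReal_mul' (h _)

/-- The positive part of the signed mixture of product Gaussians with means `(a • u i, b * r i)`. -/
noncomputable def prodMixtureMass {D : ℕ} {ι : Type*} [Fintype ι] (σ s : ℝ) (c : ι → ℝ)
    (u : ι → EuclideanSpace ℝ (Fin D)) (r : ι → ℝ) (a b : ℝ) : ENNReal :=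
  ∫⁻ z, ENNReal.ofReal (∑ i, c i * prodGaussian D σ s (z - (a • u i, b * r i)))
    ∂(volume.prod volume)

theorem prodMixtureMass_mono {D : ℕ} {ι : Type*} [Fintype ι] {σ s : ℝ}
    (hσ : 0 < σ) (hs : 0 < s) (c : ι → ℝ) (u : ι → EuclideanSpace ℝ (Fin D)) (r : ι → ℝ)
    (h : ∀ i j, c i * c j * (inner ℝ (u i) (u j) / σ ^ 2) ≤ c i * c j * (r i * r j / s ^ 2))
    (h0 : ∀ i j, 0 ≤ c i * c j * (r i * r j / s ^ 2)) (a a' b b' : ℝ) (ha' : 0 ≤ a')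
    (haa : a' ≤ a) (hab : a * (a - a') ≤ b * (b' - b)) :
    prodMixtureMass σ s c u r a b ≤ prodMixtureMass σ s c u r a' b' := by
  refine lintegral_prodGaussian_step hσ hs c _ _ fun i j => ?_
  have e : c i * c j * (inner ℝ (a' • u i - a • u i) (a • u j) / σ ^ 2
      + (b' * r i - b * r i) * (b * r j) / s ^ 2) =
      b * (b' - b) * (c i * c j * (r i * r j / s ^ 2)) -
        a * (a - a') * (c i * c j * (inner ℝ (u i) (u j) / σ ^ 2)) := by
    rw [← sub_smul, real_inner_smul_left, real_inner_smul_right]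
    ring
  change 0 ≤ c i * c j * (inner ℝ (a' • u i - a • u i) (a • u j) / σ ^ 2
      + (b' * r i - b * r i) * (b * r j) / s ^ 2)
  rw [e, sub_nonneg]
  exact (mul_le_mul_of_nonneg_left (h i j)
    (mul_nonneg (ha'.trans haa) (sub_nonneg.2 haa))).trans
    (mul_le_mul_of_nonneg_right hab (h0 i j))

theorem measurable_sum_gaussianDensity {D : ℕ} {ι : Type*} (I : Finset ι) (σ : ℝ) (c : ι → ℝ)
    (u : ι → EuclideanSpace ℝ (Fin D)) :
    Measurable fun z => ∑ i ∈ I, c i * gaussianDensity (u i) σ z :=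
  Finset.measurable_fun_sum _ fun _ _ => (measurable_gaussianDensity _ _).const_mul _

theorem measurable_sum_normalDensity {ι : Type*} (I : Finset ι) (s : ℝ) (c : ι → ℝ) (r : ι → ℝ) :
    Measurable fun t => ∑ i ∈ I, c i * normalDensity (r i) s t :=
  Finset.measurable_fun_sum _ fun _ _ => (measurable_normalDensity _ _).const_mul _

/-- One end of the path: at `b = 0` all components share the real factor, which integrates to one.
-/
theorem prodMixtureMass_zero_right {D : ℕ} {ι : Type*} [Fintype ι] {σ s : ℝ}
    (hs : 0 < s) (c : ι → ℝ) (u : ι → EuclideanSpace ℝ (Fin D)) (r : ι → ℝ) (a : ℝ) :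
    prodMixtureMass σ s c u r a 0 =
      ∫⁻ z, ENNReal.ofReal (∑ i, c i * gaussianDensity (a • u i) σ z) := by
  have e : ∀ z : EuclideanSpace ℝ (Fin D) × ℝ,
      ∑ i, c i * prodGaussian D σ s (z - (a • u i, 0 * r i)) =
        (∑ i, c i * gaussianDensity (a • u i) σ z.1) * normalDensity 0 s z.2 := by
    intro z
    rw [Finset.sum_mul]
    simp [prodGaussian, gaussianDensity_sub, mul_assoc]
  unfold prodMixtureMass
  simp only [e]
  have := lintegral_ofReal_prod_mul (μ := (volume : Measure (EuclideanSpace ℝ (Fin D))))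
    (ν := (volume : Measure ℝ)) (measurable_sum_gaussianDensity Finset.univ σ c fun i => a • u i)
    (measurable_normalDensity 0 s) (Or.inr fun t => (normalDensity_pos 0 hs t).le)
  rwa [lintegral_ofReal_normalDensity hs, mul_one] at this

theorem prodMixtureMass_zero_one {D : ℕ} {ι : Type*} [Fintype ι] {σ s : ℝ} (hσ : 0 < σ)
    (hs : 0 < s) (c : ι → ℝ) (u : ι → EuclideanSpace ℝ (Fin D)) (r : ι → ℝ) :
    prodMixtureMass σ s c u r 0 1 =
      ∫⁻ t, ENNReal.ofReal (∑ i, c i * normalDensity (r i) s t) := by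
  have e : ∀ z : EuclideanSpace ℝ (Fin D) × ℝ,
      ∑ i, c i * prodGaussian D σ s (z - ((0 : ℝ) • u i, 1 * r i)) =
        gaussianDensity 0 σ z.1 * ∑ i, c i * normalDensity (r i) s z.2 := by
    intro z
    rw [Finset.mul_sum]
    simp [prodGaussian, normalDensity_sub hs, mul_left_comm]
  unfold prodMixtureMass
  simp only [e]
  have := lintegral_ofReal_prod_mul (μ := (volume : Measure (EuclideanSpace ℝ (Fin D))))
    (ν := (volume : Measure ℝ)) (measurable_gaussianDensity 0 σ)
    (measurable_sum_normalDensity Finset.univ s c r)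
    (Or.inl fun t => (gaussianDensity_pos 0 hσ t).le)
  rwa [lintegral_ofReal_gaussianDensity hσ, one_mul] at this

/-- Gaussian comparison: mixtures with signed weights whose means have signed inner products
bounded by those of the collinear means `r i` have a smaller positive part. -/
theorem lintegral_signed_gaussianDensity_le {D : ℕ} {ι : Type*} [Fintype ι] {σ s : ℝ}
    (hσ : 0 < σ) (hs : 0 < s) (c : ι → ℝ) (u : ι → EuclideanSpace ℝ (Fin D)) (r : ι → ℝ)
    (h : ∀ i j, c i * c j * (inner ℝ (u i) (u j) / σ ^ 2) ≤ c i * c j * (r i * r j / s ^ 2))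
    (h0 : ∀ i j, 0 ≤ c i * c j * (r i * r j / s ^ 2)) :
    ∫⁻ z, ENNReal.ofReal (∑ i, c i * gaussianDensity (u i) σ z) ≤
      ∫⁻ t, ENNReal.ofReal (∑ i, c i * normalDensity (r i) s t) := by
  -- The path needs `ρ < 1`; the case `ρ = 1` follows from Fatou's lemma along `ρ = 1 - 1 / (n +
  -- 1)`.
  have hρ : Filter.Tendsto (fun n : ℕ => 1 - 1 / ((n : ℝ) + 1)) Filter.atTop (nhds 1) := by
    simpa using tendsto_one_div_add_atTop_nhds_zero_nat.const_sub (1 : ℝ)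
  have hlim : ∀ z, Filter.liminf (fun n : ℕ => ENNReal.ofReal
      (∑ i, c i * gaussianDensity ((1 - 1 / ((n : ℝ) + 1)) • u i) σ z)) Filter.atTop =
      ENNReal.ofReal (∑ i, c i * gaussianDensity (u i) σ z) := by
    intro z
    refine Filter.Tendsto.liminf_eq (ENNReal.tendsto_ofReal
      (tendsto_finsetSum _ fun i _ => Filter.Tendsto.const_mul _ ?_))
    have hc : Continuous fun a : ℝ => gaussianDensity (a • u i) σ z := by
      unfold gaussianDensity
      fun_prop
    have hc1 := hc.tendsto 1
    rw [one_smul] at hc1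
    exact hc1.comp hρ
  have hle : ∀ n : ℕ, ∫⁻ z, ENNReal.ofReal
      (∑ i, c i * gaussianDensity ((1 - 1 / ((n : ℝ) + 1)) • u i) σ z) ≤
      ∫⁻ t, ENNReal.ofReal (∑ i, c i * normalDensity (r i) s t) := by
    intro n
    rw [← prodMixtureMass_zero_right hs, ← prodMixtureMass_zero_one hσ hs c u r]
    have h1 : 1 / ((n : ℝ) + 1) ≤ 1 := by
      rw [div_le_one (by positivity)]
      linarith [(Nat.cast_nonneg n : (0 : ℝ) ≤ n)]
    have h2 : 0 < 1 / ((n : ℝ) + 1) := by positivity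
    exact le_of_forall_small_steps (Φ := prodMixtureMass σ s c u r)
      (fun a a' b b' h1 h2 _ _ h3 => prodMixtureMass_mono hσ hs c u r h h0 a a' b b' h1 h2 h3)
      (by linarith) (by linarith)
  simp_rw [← hlim]
  refine (lintegral_liminf_le (u := Filter.atTop) fun n : ℕ => (measurable_sum_gaussianDensity _ σ c
    fun i => (1 - 1 / ((n : ℝ) + 1)) • u i).ennreal_ofReal).trans ?_
  exact Filter.liminf_le_of_frequently_le' (Filter.Frequently.of_forall hle)

/-- The two mixtures with the same weights whose `i`-th means are within distance `i * L` of a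
common centre are dominated by the collinear ones. -/
theorem lintegral_mixture_sub_le {D : ℕ} {σ L : ℝ} (hσ : 0 < σ) (hL : 0 < L) (q : ℕ) (w : ℕ → ℝ)
    (hw : ∀ i, 0 ≤ w i) {α : ℝ} (hα : 0 ≤ α) (o : EuclideanSpace ℝ (Fin D))
    (u v : ℕ → EuclideanSpace ℝ (Fin D)) (hu : ∀ i ≤ q, ‖u i - o‖ ≤ i * L)
    (hv : ∀ i ≤ q, ‖v i - o‖ ≤ i * L) :
    ∫⁻ z, ENNReal.ofReal (∑ i ∈ Finset.range (q + 1), w i * gaussianDensity (u i) σ z -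
      α * ∑ i ∈ Finset.range (q + 1), w i * gaussianDensity (v i) σ z) ≤
    ∫⁻ t, ENNReal.ofReal (gaussianMixture q w 1 (σ / L) t - α * gaussianMixture q w (-1) (σ / L) t)
    := by
  have hb : ∀ a b : EuclideanSpace ℝ (Fin D), ∀ i j : ℕ, ‖a‖ ≤ i * L → ‖b‖ ≤ j * L →
      |inner ℝ a b / σ ^ 2| ≤ i * j / (σ / L) ^ 2 := by
    intro a b i j ha hb
    have e : (i * j / (σ / L) ^ 2 : ℝ) = (i * L) * (j * L) / σ ^ 2 := by field_simp
    rw [abs_div, abs_of_nonneg (sq_nonneg σ), e]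
    gcongr
    exact (abs_real_inner_le_norm a b).trans (by gcongr)
  have hle : ∀ i : Fin (q + 1), (i : ℕ) ≤ q := fun i => Nat.lt_succ_iff.1 i.2
  -- Both mixtures form one signed family: weights `w i` with collinear means `i`, and weights `-α *
  -- w i` with means `-i`. Thus `c i * r i ≥ 0`, and Cauchy–Schwarz gives the inner product bounds.
  have key := lintegral_signed_gaussianDensity_le hσ (div_pos hσ hL)
    (Sum.elim (fun i : Fin (q + 1) => w i) (fun i : Fin (q + 1) => -(α * w i)))
    (Sum.elim (fun i : Fin (q + 1) => u i - o) (fun i : Fin (q + 1) => v i - o))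
    (Sum.elim (fun i : Fin (q + 1) => (1 : ℝ) * i) (fun i : Fin (q + 1) => (-1 : ℝ) * i)) ?_ ?_
  · simp only [Fintype.sum_sum_type, Sum.elim_inl, Sum.elim_inr] at key
    rw [← lintegral_sub_right_eq_self _ o] at key
    refine (lintegral_congr fun z => ?_).trans_le (key.trans_eq (lintegral_congr fun t => ?_))
    · congr 1
      simp only [Finset.sum_range, neg_mul, Finset.sum_neg_distrib, Finset.mul_sum, mul_assoc,
        ← sub_eq_add_neg, gaussianDensity, sub_sub_sub_cancel_right]
    · congr 1
      simp only [gaussianMixture, Finset.sum_range, Finset.sum_neg_distrib, Finset.mul_sum,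
        neg_mul, mul_assoc, ← sub_eq_add_neg]
  · rintro (i | i) (j | j) <;> simp only [Sum.elim_inl, Sum.elim_inr]
    · have := abs_le.1 (hb _ _ i j (hu i (hle i)) (hu j (hle j)))
      rw [one_mul, one_mul]
      exact mul_le_mul_of_nonneg_left this.2 (mul_nonneg (hw _) (hw _))
    · have := abs_le.1 (hb _ _ i j (hu i (hle i)) (hv j (hle j)))
      refine mul_le_mul_of_nonpos_left ?_ ?_
      · rw [show (1 * (i : ℝ) * (-1 * j)) = -(i * j) by ring, neg_div]
        exact this.1
      · nlinarith [mul_nonneg hα (mul_nonneg (hw i) (hw j))]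
    · have := abs_le.1 (hb _ _ i j (hv i (hle i)) (hu j (hle j)))
      refine mul_le_mul_of_nonpos_left ?_ ?_
      · rw [show (-1 * (i : ℝ) * (1 * j)) = -(i * j) by ring, neg_div]
        exact this.1
      · nlinarith [mul_nonneg hα (mul_nonneg (hw i) (hw j))]
    · have := abs_le.1 (hb _ _ i j (hv i (hle i)) (hv j (hle j)))
      rw [show (-1 * (i : ℝ) * (-1 * j)) = i * j by ring, neg_mul_neg]
      exact mul_le_mul_of_nonneg_left this.2
        (mul_nonneg (mul_nonneg hα (hw _)) (mul_nonneg hα (hw _)))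
  · rintro (i | i) (j | j) <;> simp only [Sum.elim_inl, Sum.elim_inr]
    · have := hw i
      have := hw j
      positivity
    · have e : w i * -(α * w j) * (1 * (i : ℝ) * (-1 * j) / (σ / L) ^ 2) =
          w i * (α * w j) * (i * j / (σ / L) ^ 2) := by ring
      have := hw i
      have := hw j
      rw [e]
      positivity
    · have e : -(α * w i) * w j * (-1 * (i : ℝ) * (1 * j) / (σ / L) ^ 2) =
          (α * w i) * w j * (i * j / (σ / L) ^ 2) := by ring
      have := hw i
      have := hw j
      rw [e]
      positivity
    · have e : -(α * w i) * -(α * w j) * (-1 * (i : ℝ) * (-1 * j) / (σ / L) ^ 2) =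
          (α * w i) * (α * w j) * (i * j / (σ / L) ^ 2) := by ring
      have := hw i
      have := hw j
      rw [e]
      positivity

/-! ### Nested coupling of batches. -/

section Subsampling

universe u

variable {A : Type u} [DecidableEq A]

/-- Double counting of the pairs `(z, c)` through `y = c ::ₘ z`. -/
theorem sum_sym_cons (x : Finset A) (q : ℕ) (F : Multiset A → A → ℝ) :
    ∑ z ∈ x.sym q, ∑ c ∈ x, F (z : Multiset A) c =
      ∑ y ∈ x.sym (q + 1), ∑ c ∈ x, if c ∈ (y : Multiset A) then
        F ((y : Multiset A).erase c) c else 0 := by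
  rw [Finset.sum_comm, Finset.sum_comm (s := x.sym (q + 1))]
  refine Finset.sum_congr rfl fun c hc => ?_
  rw [← Finset.sum_filter]
  refine Finset.sum_bij' (fun z _ => c ::ₛ z)
    (fun y hy => y.erase c (Sym.mem_coe.1 (Finset.mem_filter.1 hy).2)) ?_ ?_ ?_ ?_ ?_
  · intro z hz
    simp only [Finset.mem_filter, Finset.mem_sym_iff] at hz ⊢
    refine ⟨fun b hb => ?_, by simp⟩
    rcases Sym.mem_cons.1 hb with rfl | hb
    exacts [hc, hz b hb]
  · intro y hy
    simp only [Finset.mem_filter, Finset.mem_sym_iff] at hy ⊢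
    exact fun b hb => hy.1 b (Multiset.mem_of_mem_erase hb)
  · intro z hz
    exact Sym.erase_cons_head z c _
  · intro y hy
    exact Sym.cons_erase _
  · intro z hz
    rw [Sym.coe_cons, Multiset.erase_cons_head]

/-- Sequential (Pólya-type) coupling of random multisets of sizes `q, q - 1, …, 0`: each multiset is
obtained from the next smaller one by adding one element. -/
theorem exists_nested_coupling (x : Finset A) (s : ℕ → Multiset A → ℝ)
    (κ : ℕ → Multiset A → A → ℝ) (hs0 : s 0 0 = 1) (hκ0 : ∀ k z c, 0 ≤ κ k z c)
    (hκ1 : ∀ k z, Multiset.card z = k → ∑ c ∈ x, κ k z c = 1 ∨ ∃ b ∈ z, b ∉ x)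
    (hrec : ∀ k, ∀ y : Multiset A, Multiset.card y = k + 1 → (∀ b ∈ y, b ∈ x) →
      s (k + 1) y = ∑ c ∈ x, if c ∈ y then s k (y.erase c) * κ k (y.erase c) c else 0) (q : ℕ) :
    ∃ (Ω : Type u) (_ : Fintype Ω) (p : Ω → ℝ) (z : ℕ → Ω → Multiset A),
      (∀ ω, 0 ≤ p ω) ∧ ∑ ω, p ω = 1 ∧
      (∀ ω, ∀ i ≤ q, Multiset.card (z i ω) = q - i ∧ ∀ b ∈ z i ω, b ∈ x) ∧
      (∀ ω, ∀ i < q, ∃ c, z i ω = c ::ₘ z (i + 1) ω) ∧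
      ∀ i ≤ q, ∀ B : Multiset A → ℝ,
        ∑ y ∈ x.sym (q - i), s (q - i) (y : Multiset A) * B (y : Multiset A) =
          ∑ ω, p ω * B (z i ω) := by
  induction q with
  | zero =>
    refine ⟨PUnit, inferInstance, fun _ => 1, fun _ _ => 0, by simp, by simp, by simp, by simp, ?_⟩
    intro i hi B
    obtain rfl : i = 0 := by omega
    have h : ((∅ : Sym A 0) : Multiset A) = 0 := rfl
    simp [h, hs0]
  | succ q ih =>
    obtain ⟨Ω, _, p, z, hp0, hp1, hz, hchain, hmarg⟩ := ih
    have hκ : ∀ ω, ∑ c : x, κ q (z 0 ω) c = 1 := by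
      intro ω
      obtain ⟨h1, h2⟩ := hz ω 0 (Nat.zero_le _)
      rw [Finset.sum_coe_sort x (fun c => κ q (z 0 ω) c)]
      refine (hκ1 q _ (by simpa using h1)).resolve_right ?_
      rintro ⟨b, hb, hbx⟩
      exact hbx (h2 b hb)
    -- The new largest multiset takes index `0`, and the old sequence shifts up by one.
    refine ⟨Ω × x, inferInstance, fun ω => p ω.1 * κ q (z 0 ω.1) ω.2,
      fun i ω => Nat.casesOn i (ω.2.1 ::ₘ z 0 ω.1) (fun j => z j ω.1), ?_, ?_, ?_, ?_, ?_⟩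
    · exact fun ω => mul_nonneg (hp0 _) (hκ0 _ _ _)
    · rw [Fintype.sum_prod_type]
      simp only [← Finset.mul_sum, hκ, mul_one, hp1]
    · rintro ω (_ | i) hi
      · obtain ⟨h1, h2⟩ := hz ω.1 0 (Nat.zero_le _)
        refine ⟨by simpa using h1, fun b hb => ?_⟩
        rcases Multiset.mem_cons.1 hb with rfl | hb
        exacts [ω.2.2, h2 b hb]
      · simpa using hz ω.1 i (by omega)
    · rintro ω (_ | i) hi
      · exact ⟨ω.2.1, rfl⟩
      · exact hchain ω.1 i (by omega)
    · rintro (_ | i) hi B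
      · have h0 := hmarg 0 (Nat.zero_le _) fun y => ∑ c ∈ x, κ q y c * B (c ::ₘ y)
        simp only [Nat.sub_zero, Finset.mul_sum] at h0
        have h1 := sum_sym_cons x q fun y c => s q y * (κ q y c * B (c ::ₘ y))
        rw [Fintype.sum_prod_type]
        calc _ = ∑ y ∈ x.sym (q + 1), ∑ c ∈ x, (if c ∈ (y : Multiset A) then
                s q ((y : Multiset A).erase c) * (κ q ((y : Multiset A).erase c) c *
                  B (c ::ₘ (y : Multiset A).erase c)) else 0) := by
              refine Finset.sum_congr rfl fun y hy => ?_
              change s (q + 1) (y : Multiset A) * _ = _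
              rw [hrec q y y.2 (Finset.mem_sym_iff.1 hy), Finset.sum_mul]
              refine Finset.sum_congr rfl fun c _ => ?_
              split_ifs with hc
              · rw [Multiset.cons_erase hc, mul_assoc]
              · rw [zero_mul]
          _ = _ := h1.symm.trans (h0.trans (Finset.sum_congr rfl fun ω _ => ?_))
        rw [← Finset.sum_coe_sort x (fun c => p ω * (κ q (z 0 ω) c * B (c ::ₘ z 0 ω)))]
        exact Finset.sum_congr rfl fun c _ => (mul_assoc _ _ _).symm
      · have := hmarg i (by omega) B
        rw [Nat.add_sub_add_right, this, Fintype.sum_prod_type]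
        refine Finset.sum_congr rfl fun ω _ => ?_
        change _ = ∑ c : x, p ω * κ q (z 0 ω) c * B (z i ω)
        rw [← Finset.sum_mul, ← Finset.mul_sum, hκ, mul_one]

theorem sum_sym_insert {x : Finset A} {a : A} (ha : a ∉ x) (q : ℕ) (f : Multiset A → ℝ) :
    ∑ y ∈ (insert a x).sym q, f y = ∑ i ∈ Finset.range (q + 1), ∑ z ∈ x.sym (q - i),
      f (z + Multiset.replicate i a) := by
  rw [Finset.sum_range fun i => ∑ z ∈ x.sym (q - i), f (z + Multiset.replicate i a),
    ← Finset.sum_coe_sort, ← (Finset.symInsertEquiv ha).symm.sum_comp, Fintype.sum_sigma]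
  refine Finset.sum_congr rfl fun i _ => ?_
  rw [← Finset.sum_coe_sort (x.sym (q - i)) fun z => f ((z : Multiset A) +
    Multiset.replicate i a)]
  rfl

/-! ### Recursions and conditional laws of the two schemes. -/

theorem countPerms_cons (c : A) (z : Multiset A) :
    (c ::ₘ z).countPerms * (z.count c + 1) = (Multiset.card z + 1) * z.countPerms := by
  rw [Multiset.countPerms_filter_ne c, Multiset.countPerms_filter_ne c z]
  simp only [Multiset.card_cons, Multiset.count_cons_self, ne_eq, not_true_eq_false,
    not_false_eq_true, Multiset.filter_cons_of_neg]
  have := Nat.add_one_mul_choose_eq (Multiset.card z) (z.count c)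
  rw [mul_right_comm, ← this, mul_assoc]

theorem countPerms_add_replicate {a : A} {z : Multiset A} (ha : a ∉ z) (i : ℕ) :
    (z + Multiset.replicate i a).countPerms =
      (Multiset.card z + i).choose i * z.countPerms := by
  rw [Multiset.countPerms_filter_ne a]
  have h1 : Multiset.filter (a ≠ ·) z = z :=
    Multiset.filter_eq_self.2 fun b hb h => ha (h ▸ hb)
  have h2 : Multiset.filter (a ≠ ·) (Multiset.replicate i a) = 0 :=
    Multiset.filter_eq_nil.2 fun b hb h => h (Multiset.eq_of_mem_replicate hb).symm
  rw [Multiset.filter_add, h1, h2, add_zero, Multiset.count_add, Multiset.count_replicate_self,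
    Multiset.count_eq_zero_of_notMem ha, zero_add, Multiset.card_add, Multiset.card_replicate]

theorem multichoose_pos {n k : ℕ} (h : 0 < n) : 0 < n.multichoose k := by
  rw [Nat.multichoose_eq]
  exact Nat.choose_pos (by omega)

theorem multichoose_succ_mul {n : ℕ} (h : 0 < n) (k : ℕ) :
    n.multichoose (k + 1) * (k + 1) = (n + k) * n.multichoose k := by
  obtain ⟨m, rfl⟩ := Nat.exists_eq_succ_of_ne_zero h.ne'
  rw [Nat.multichoose_eq, Nat.multichoose_eq]
  have := Nat.add_one_mul_choose_eq (m + k) k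
  rw [show m.succ + (k + 1) - 1 = m + k + 1 by omega, show m.succ + k - 1 = m + k by omega,
    ← this]
  congr 1
  omega

theorem iidPMF_of_mem {q : ℕ} {x : Finset A} {y : Multiset A} (hq : Multiset.card y = q)
    (hy : ∀ b ∈ y, b ∈ x) : iidPMF q x y = (y.countPerms : ℝ) / (x.card : ℝ) ^ q :=
  if_pos ⟨hq, hy⟩

theorem uniformMultisetPMF_of_mem {q : ℕ} {x : Finset A} {y : Multiset A}
    (hq : Multiset.card y = q) (hy : ∀ b ∈ y, b ∈ x) :
    uniformMultisetPMF q x y = ((x.card.multichoose q : ℕ) : ℝ)⁻¹ :=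
  if_pos ⟨hq, hy⟩

/-- Conditioning on the last draw `c`: it accounts for the fraction `y.count c / (k + 1)` of the
probability of `y`, and the multiplicities sum to `k + 1`. -/
theorem iidPMF_succ {x : Finset A} (k : ℕ) (y : Multiset A) (hk : Multiset.card y = k + 1)
    (hy : ∀ b ∈ y, b ∈ x) :
    iidPMF (k + 1) x y =
      ∑ c ∈ x, if c ∈ y then iidPMF k x (y.erase c) * (1 / (x.card : ℝ)) else 0 := by
  have hterm : ∀ c ∈ x, (if c ∈ y then iidPMF k x (y.erase c) * (1 / (x.card : ℝ)) else 0) =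
      (y.count c : ℝ) * ((y.countPerms : ℝ) / (x.card : ℝ) ^ (k + 1) / (k + 1)) := by
    intro c _
    split_ifs with hc
    · have hcard : Multiset.card (y.erase c) = k := by
        rw [Multiset.card_erase_of_mem hc, hk, Nat.pred_succ]
      rw [iidPMF_of_mem hcard fun b hb => hy b (Multiset.mem_of_mem_erase hb)]
      have h1 := countPerms_cons c (y.erase c)
      rw [Multiset.cons_erase hc, hcard, Multiset.count_erase_self,
        Nat.sub_add_cancel (Multiset.one_le_count_iff_mem.2 hc)] at h1
      have h2 : (y.countPerms : ℝ) * y.count c = (k + 1) * (y.erase c).countPerms := by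
        exact_mod_cast h1
      have h3 : (k + 1 : ℝ) ≠ 0 := by positivity
      have h4 : ((y.erase c).countPerms : ℝ) = y.countPerms * y.count c / (k + 1) := by
        rw [h2]; field_simp
      rw [h4, pow_succ]
      ring
    · rw [Multiset.count_eq_zero_of_notMem hc, Nat.cast_zero, zero_mul]
  rw [Finset.sum_congr rfl hterm, ← Finset.sum_mul, iidPMF_of_mem hk hy, ← Nat.cast_sum,
    Multiset.sum_count_eq_card hy, hk]
  have h3 : (k + 1 : ℝ) ≠ 0 := by positivity
  push_cast
  field_simp

/-- Pólya's urn: adding `c` with probability proportional to its current multiplicity plus one keeps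
the multiset uniform, since the term of `c` is proportional to `y.count c`. -/
theorem uniformMultisetPMF_succ {x : Finset A} (hx : 0 < x.card) (k : ℕ) (y : Multiset A)
    (hk : Multiset.card y = k + 1) (hy : ∀ b ∈ y, b ∈ x) :
    uniformMultisetPMF (k + 1) x y =
      ∑ c ∈ x, if c ∈ y then uniformMultisetPMF k x (y.erase c) *
        (((y.erase c).count c + 1 : ℝ) / (x.card + k)) else 0 := by
  have hterm : ∀ c ∈ x, (if c ∈ y then uniformMultisetPMF k x (y.erase c) *
        (((y.erase c).count c + 1 : ℝ) / (x.card + k)) else 0) =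
      (y.count c : ℝ) * (((x.card.multichoose k : ℕ) : ℝ)⁻¹ / (x.card + k)) := by
    intro c _
    split_ifs with hc
    · have hcard : Multiset.card (y.erase c) = k := by
        rw [Multiset.card_erase_of_mem hc, hk, Nat.pred_succ]
      rw [uniformMultisetPMF_of_mem hcard fun b hb => hy b (Multiset.mem_of_mem_erase hb),
        Multiset.count_erase_self, Nat.cast_sub (Multiset.one_le_count_iff_mem.2 hc)]
      push_cast
      ring
    · rw [Multiset.count_eq_zero_of_notMem hc, Nat.cast_zero, zero_mul]
  rw [Finset.sum_congr rfl hterm, ← Finset.sum_mul, uniformMultisetPMF_of_mem hk hy,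
    ← Nat.cast_sum, Multiset.sum_count_eq_card hy, hk]
  have h1 : ((x.card.multichoose (k + 1) : ℕ) : ℝ) * (k + 1) =
      (x.card + k) * (x.card.multichoose k : ℕ) := by
    exact_mod_cast multichoose_succ_mul hx k
  have h2 : ((x.card.multichoose (k + 1) : ℕ) : ℝ) ≠ 0 :=
    Nat.cast_ne_zero.2 (multichoose_pos hx).ne'
  have h3 : ((x.card.multichoose k : ℕ) : ℝ) ≠ 0 := Nat.cast_ne_zero.2 (multichoose_pos hx).ne'
  have h4 : (x.card + k : ℝ) ≠ 0 := by positivity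
  push_cast
  field_simp
  linear_combination -h1

theorem iidPMF_add_replicate {x : Finset A} {a : A} (ha : a ∉ x) {q i : ℕ} (hi : i ≤ q)
    {z : Multiset A} (hz : Multiset.card z = q - i) (hzx : ∀ b ∈ z, b ∈ x) :
    iidPMF q (insert a x) (z + Multiset.replicate i a) =
      iidWeight (insert a x).card q i * iidPMF (q - i) x z := by
  -- This includes empty `x`: then `z` is empty and the exponent is zero.
  have hne : (x.card : ℝ) ^ (q - i) ≠ 0 := by
    rcases Nat.eq_zero_or_pos (q - i) with h | h
    · simp [h]
    · obtain ⟨b, hb⟩ := Multiset.card_pos_iff_exists_mem.1 (hz.symm ▸ h)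
      have : 0 < x.card := Finset.card_pos.2 ⟨b, hzx b hb⟩
      positivity
  rw [iidPMF_of_mem hz hzx, iidPMF_of_mem, countPerms_add_replicate fun h => ha (hzx a h), hz,
    Nat.sub_add_cancel hi, Finset.card_insert_of_notMem ha, iidWeight]
  · have h1 : (1 - 1 / ((x.card + 1 : ℕ) : ℝ)) = x.card / ((x.card + 1 : ℕ) : ℝ) := by
      push_cast
      field_simp
      ring
    have h2 : ((x.card + 1 : ℕ) : ℝ) ^ q = ((x.card + 1 : ℕ) : ℝ) ^ i *
        ((x.card + 1 : ℕ) : ℝ) ^ (q - i) := by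
      rw [← pow_add, Nat.add_sub_cancel' hi]
    rw [h1, h2, div_pow, div_pow, one_pow]
    push_cast
    field_simp
  · rw [Multiset.card_add, hz, Multiset.card_replicate, Nat.sub_add_cancel hi]
  · intro b hb
    rcases Multiset.mem_add.1 hb with hb | hb
    · exact Finset.mem_insert_of_mem (hzx b hb)
    · exact Multiset.eq_of_mem_replicate hb ▸ Finset.mem_insert_self a x

theorem uniformMultisetPMF_add_replicate {x : Finset A} {a : A} (ha : a ∉ x) {q i : ℕ}
    (hi : i ≤ q) {z : Multiset A} (hz : Multiset.card z = q - i) (hzx : ∀ b ∈ z, b ∈ x) :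
    uniformMultisetPMF q (insert a x) (z + Multiset.replicate i a) =
      uniformMultisetWeight (insert a x).card q i * uniformMultisetPMF (q - i) x z := by
  have hne : ((x.card.multichoose (q - i) : ℕ) : ℝ) ≠ 0 := by
    rcases Nat.eq_zero_or_pos (q - i) with h | h
    · simp [h, Nat.multichoose_zero_right]
    · obtain ⟨b, hb⟩ := Multiset.card_pos_iff_exists_mem.1 (hz.symm ▸ h)
      exact Nat.cast_ne_zero.2 (multichoose_pos (Finset.card_pos.2 ⟨b, hzx b hb⟩)).ne'
  rw [uniformMultisetPMF_of_mem hz hzx, uniformMultisetPMF_of_mem,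
    Finset.card_insert_of_notMem ha, uniformMultisetWeight, Nat.add_sub_cancel]
  · field_simp
  · rw [Multiset.card_add, hz, Multiset.card_replicate, Nat.sub_add_cancel hi]
  · intro b hb
    rcases Multiset.mem_add.1 hb with hb | hb
    · exact Finset.mem_insert_of_mem (hzx b hb)
    · exact Multiset.eq_of_mem_replicate hb ▸ Finset.mem_insert_self a x

/-! ### From the coupling to the divergence bound. -/

theorem hockeyStick_eq {E : Type*} [MeasureSpace E] (α : ℝ) (p r : E → ℝ) (hr : ∀ z, 0 < r z) :
    hockeyStick α p r = ∫⁻ z, ENNReal.ofReal (p z - α * r z) := by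
  refine lintegral_congr fun z => ?_
  rw [max_mul_of_nonneg _ _ (hr z).le, zero_mul, sub_mul, div_mul_cancel₀ _ (hr z).ne',
    ENNReal.ofReal_max, ENNReal.ofReal_zero, max_eq_left zero_le]

theorem sum_mul_pos {q : ℕ} {w : ℕ → ℝ} (hw : ∀ i, 0 ≤ w i) (hwq : 0 < w q) (f : ℕ → ℝ)
    (hf : ∀ i, 0 < f i) : 0 < ∑ i ∈ Finset.range (q + 1), w i * f i :=
  Finset.sum_pos' (fun i _ => mul_nonneg (hw i) (hf i).le)
    ⟨q, Finset.self_mem_range_succ q, mul_pos hwq (hf q)⟩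

/-- Joint convexity: the positive part is subadditive, and each outcome `ω` obeys the same bound, so
averaging preserves it. -/
theorem hockeyStick_le_of_coupling {D : ℕ} {σ L : ℝ} (hσ : 0 < σ) (hL : 0 < L) (q : ℕ) (w : ℕ → ℝ)
    (hw : ∀ i, 0 ≤ w i) (hwq : 0 < w q) {α : ℝ} (hα : 0 ≤ α) {Ω : Type*} [Fintype Ω] (p : Ω → ℝ)
    (hp0 : ∀ ω, 0 ≤ p ω) (hp1 : ∑ ω, p ω = 1) (o : Ω → EuclideanSpace ℝ (Fin D))
    (u v : ℕ → Ω → EuclideanSpace ℝ (Fin D)) (hu : ∀ ω, ∀ i ≤ q, ‖u i ω - o ω‖ ≤ i * L)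
    (hv : ∀ ω, ∀ i ≤ q, ‖v i ω - o ω‖ ≤ i * L) (m m' : EuclideanSpace ℝ (Fin D) → ℝ)
    (hm : ∀ z, m z = ∑ ω, p ω * ∑ i ∈ Finset.range (q + 1), w i * gaussianDensity (u i ω) σ z)
    (hm' : ∀ z, m' z = ∑ ω, p ω * ∑ i ∈ Finset.range (q + 1), w i * gaussianDensity (v i ω) σ z) :
    hockeyStick α m m' ≤ hockeyStick α (gaussianMixture q w 1 (σ / L))
      (gaussianMixture q w (-1) (σ / L)) := by
  have hin : ∀ (u : ℕ → Ω → EuclideanSpace ℝ (Fin D)) ω z,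
      0 < ∑ i ∈ Finset.range (q + 1), w i * gaussianDensity (u i ω) σ z := fun u ω z =>
    sum_mul_pos hw hwq _ fun i => gaussianDensity_pos _ hσ _
  have hpos : ∀ z, 0 < m' z := by
    intro z
    rw [hm']
    obtain ⟨ω, -, hω⟩ := Finset.exists_ne_zero_of_sum_ne_zero (hp1.trans_ne one_ne_zero)
    exact Finset.sum_pos' (fun ω _ => mul_nonneg (hp0 ω) (hin v ω z).le)
      ⟨ω, Finset.mem_univ _, mul_pos (lt_of_le_of_ne (hp0 ω) hω.symm) (hin v ω z)⟩
  rw [hockeyStick_eq α _ _ hpos, hockeyStick_eq α _ (gaussianMixture q w (-1) (σ / L)) fun t =>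
    sum_mul_pos hw hwq _ fun i => normalDensity_pos _ (div_pos hσ hL) _]
  set f : Ω → EuclideanSpace ℝ (Fin D) → ℝ := fun ω z =>
    ∑ i ∈ Finset.range (q + 1), w i * gaussianDensity (u i ω) σ z -
      α * ∑ i ∈ Finset.range (q + 1), w i * gaussianDensity (v i ω) σ z with hf
  have hfm : ∀ ω, Measurable (f ω) := fun ω =>
    (measurable_sum_gaussianDensity _ σ w fun i => u i ω).sub
      ((measurable_sum_gaussianDensity _ σ w fun i => v i ω).const_mul α)
  have hmf : ∀ z, m z - α * m' z = ∑ ω, p ω * f ω z := by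
    intro z
    rw [hm, hm', Finset.mul_sum, ← Finset.sum_sub_distrib]
    exact Finset.sum_congr rfl fun ω _ => by rw [hf]; ring
  set R := ∫⁻ t, ENNReal.ofReal (gaussianMixture q w 1 (σ / L) t -
    α * gaussianMixture q w (-1) (σ / L) t)
  calc ∫⁻ z, ENNReal.ofReal (m z - α * m' z)
      ≤ ∫⁻ z, ∑ ω, ENNReal.ofReal (p ω) * ENNReal.ofReal (f ω z) := by
        refine lintegral_mono fun z => ?_
        rw [hmf]
        refine (Finset.le_sum_of_subadditive ENNReal.ofReal ENNReal.ofReal_zero.le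
          (fun _ _ => ENNReal.ofReal_add_le) _ _).trans_eq ?_
        exact Finset.sum_congr rfl fun ω _ => ENNReal.ofReal_mul (hp0 ω)
    _ = ∑ ω, ENNReal.ofReal (p ω) * ∫⁻ z, ENNReal.ofReal (f ω z) := by
        rw [lintegral_finsetSum _ fun ω _ => (hfm ω).ennreal_ofReal.const_mul _]
        exact Finset.sum_congr rfl fun ω _ => lintegral_const_mul _ (hfm ω).ennreal_ofReal
    _ ≤ ∑ ω, ENNReal.ofReal (p ω) * R := by
        gcongr with ω
        exact lintegral_mixture_sub_le hσ hL q w hw hα (o ω) (fun i => u i ω) (fun i => v i ω)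
          (hu ω) (hv ω)
    _ = R := by
        rw [← Finset.sum_mul, ← ENNReal.ofReal_sum_of_nonneg fun ω _ => hp0 ω, hp1,
          ENNReal.ofReal_one, one_mul]

theorem norm_sub_le_of_chain {D : ℕ} {Y : Set (Multiset A)}
    {h : Multiset A → EuclideanSpace ℝ (Fin D)} (hbdd : BddAbove (substGaps Y h)) {q : ℕ}
    (y : ℕ → Multiset A) (hy : ∀ i ≤ q, y i ∈ Y) (hyy : ∀ i < q, BatchSubst (y i) (y (i + 1)))
    {i : ℕ} (hi : i ≤ q) : ‖h (y i) - h (y 0)‖ ≤ i * l2Sensitivity Y h := by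
  induction i with
  | zero => simp
  | succ i ih =>
    have h1 : ‖h (y i) - h (y (i + 1))‖ ≤ l2Sensitivity Y h :=
      le_csSup hbdd ⟨_, hy i (by omega), _, hy _ hi, hyy i hi, rfl⟩
    rw [norm_sub_rev] at h1
    have h2 := norm_sub_le_norm_sub_add_norm_sub (h (y (i + 1))) (h (y i)) (h (y 0))
    push_cast
    linarith [ih (by omega)]

theorem batchSubst_add_replicate (z : Multiset A) (c a : A) (i : ℕ) :
    BatchSubst (c ::ₘ z + Multiset.replicate i a) (z + Multiset.replicate (i + 1) a) := by
  refine ⟨c, by simp, a, ?_⟩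
  rw [Multiset.cons_add, Multiset.erase_cons_head, Multiset.replicate_succ, Multiset.add_cons]

/-- Mixture decomposition of the subsampled density by the multiplicity of one record. -/
theorem subsampledDensity_insert {D q : ℕ} (S : ℕ → Finset A → Multiset A → ℝ) (w : ℕ → ℝ)
    (h : Multiset A → EuclideanSpace ℝ (Fin D)) (σ : ℝ) {x : Finset A} {a : A} (ha : a ∉ x)
    (hS : ∀ i ≤ q, ∀ z : Multiset A, Multiset.card z = q - i → (∀ b ∈ z, b ∈ x) →
      S q (insert a x) (z + Multiset.replicate i a) = w i * S (q - i) x z)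
    (t : EuclideanSpace ℝ (Fin D)) :
    subsampledDensity q (S q) h σ (insert a x) t = ∑ i ∈ Finset.range (q + 1), w i *
      ∑ z ∈ x.sym (q - i), S (q - i) x (z : Multiset A) *
        gaussianDensity (h ((z : Multiset A) + Multiset.replicate i a)) σ t := by
  unfold subsampledDensity
  rw [sum_sym_insert ha q fun y => S q (insert a x) y * gaussianDensity (h y) σ t]
  refine Finset.sum_congr rfl fun i hi => ?_
  rw [Finset.mul_sum]
  refine Finset.sum_congr rfl fun z hz => ?_
  rw [hS i (Nat.lt_succ_iff.1 (Finset.mem_range.1 hi)) z z.2 (Finset.mem_sym_iff.1 hz), mul_assoc]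

/-- Common form of both schemes: `S k` is the law of a batch of size `k`, `w` the law of the
multiplicity of the exchanged record, and `κ` the kernel that adds one record. Nonemptiness is
assumed for `κ` because no kernel on an empty set has mass one. -/
theorem hockeyStick_subsampledDensity_le {D q : ℕ} {σ : ℝ} (hσ : 0 < σ) {α : ℝ} (hα : 0 ≤ α)
    (Y : Set (Multiset A)) (h : Multiset A → EuclideanSpace ℝ (Fin D))
    (hbdd : BddAbove (substGaps Y h)) (hpos : 0 < l2Sensitivity Y h)
    (S : ℕ → Finset A → Multiset A → ℝ) (w : ℕ → ℝ) (hw : ∀ i, 0 ≤ w i) (hwq : 0 < w q)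
    {x : Finset A} {a a' : A} (ha : a ∉ x) (ha' : a' ∉ x)
    (hY : ∀ y : Multiset A, Multiset.card y = q → (∀ b ∈ y, b ∈ insert a x) → y ∈ Y)
    (hY' : ∀ y : Multiset A, Multiset.card y = q → (∀ b ∈ y, b ∈ insert a' x) → y ∈ Y)
    (hY0 : x = ∅ → ∀ y : Multiset A, Multiset.card y = q → (∀ b ∈ y, b = a ∨ b = a') → y ∈ Y)
    (hS : ∀ b ∉ x, ∀ i ≤ q, ∀ z : Multiset A, Multiset.card z = q - i → (∀ b ∈ z, b ∈ x) →
      S q (insert b x) (z + Multiset.replicate i b) = w i * S (q - i) x z)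
    (hS0 : S 0 x 0 = 1) (hw0 : x = ∅ → ∀ i < q, w i = 0) (κ : ℕ → Multiset A → A → ℝ)
    (hκ0 : ∀ k z c, 0 ≤ κ k z c)
    (hκ1 : x.Nonempty → ∀ k z, Multiset.card z = k → ∑ c ∈ x, κ k z c = 1 ∨ ∃ b ∈ z, b ∉ x)
    (hrec : x.Nonempty → ∀ k, ∀ y : Multiset A, Multiset.card y = k + 1 → (∀ b ∈ y, b ∈ x) →
      S (k + 1) x y =
        ∑ c ∈ x, if c ∈ y then S k x (y.erase c) * κ k (y.erase c) c else 0) :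
    hockeyStick α (subsampledDensity q (S q) h σ (insert a x))
        (subsampledDensity q (S q) h σ (insert a' x)) ≤
      hockeyStick α (gaussianMixture q w 1 (σ / l2Sensitivity Y h))
        (gaussianMixture q w (-1) (σ / l2Sensitivity Y h)) := by
  rcases x.eq_empty_or_nonempty with hx | hx
  · have hred : ∀ b ∉ x, ∀ y : ℕ → Multiset A, y q = Multiset.replicate q b → ∀ t,
        subsampledDensity q (S q) h σ (insert b x) t =
          ∑ _ω : Unit, (1 : ℝ) *
            ∑ i ∈ Finset.range (q + 1), w i * gaussianDensity (h (y i)) σ t := by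
      intro b hb y hy t
      rw [subsampledDensity_insert S w h σ hb (hS b hb), Fintype.sum_unique, one_mul]
      refine Finset.sum_congr rfl fun i hi => ?_
      rcases (Nat.lt_succ_iff.1 (Finset.mem_range.1 hi)).lt_or_eq with hi | rfl
      · rw [hw0 hx i hi, zero_mul, zero_mul]
      · have h0 : ((∅ : Sym A 0) : Multiset A) = 0 := rfl
        rw [Nat.sub_self, Finset.sym_zero, Finset.sum_singleton, h0, hS0, one_mul, zero_add, hy]
    -- Only `i = q` has nonzero weight, so the other means are free to choose. The centre is `h` of
    -- `q` copies of `a`, from which the mixed batches lead to `q` copies of `a'` in `q`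
    -- substitutions.
    refine hockeyStick_le_of_coupling hσ hpos q w hw hwq hα (fun _ : Unit => (1 : ℝ))
      (fun _ => zero_le_one) (by simp) (fun _ => h (Multiset.replicate q a))
      (fun _ _ => h (Multiset.replicate q a))
      (fun i _ => h (Multiset.replicate (q - i) a + Multiset.replicate i a')) ?_ ?_ _ _
      (hred a ha (fun _ => Multiset.replicate q a) rfl)
      (hred a' ha' (fun i => Multiset.replicate (q - i) a + Multiset.replicate i a') (by simp))
    · intro _ i _
      rw [sub_self, norm_zero]
      positivity
    · intro _ i hi
      have := norm_sub_le_of_chain hbdd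
        (fun i => Multiset.replicate (q - i) a + Multiset.replicate i a') (q := q) ?_ ?_ hi
      · simpa using this
      · intro i hi
        refine hY0 hx _ (by simp [hi]) fun b hb => ?_
        rcases Multiset.mem_add.1 hb with hb | hb
        exacts [Or.inl (Multiset.eq_of_mem_replicate hb), Or.inr (Multiset.eq_of_mem_replicate hb)]
      · intro i hi
        have := batchSubst_add_replicate (Multiset.replicate (q - (i + 1)) a) a a' i
        rwa [← Multiset.replicate_succ, show q - (i + 1) + 1 = q - i by omega] at this
  · obtain ⟨Ω, _, p, z, hp0, hp1, hz, hchain, hmarg⟩ :=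
      exists_nested_coupling x (fun k => S k x) κ hS0 hκ0 (hκ1 hx) (hrec hx) q
    have hdens : ∀ b ∉ x, ∀ t, subsampledDensity q (S q) h σ (insert b x) t =
        ∑ ω, p ω * ∑ i ∈ Finset.range (q + 1), w i *
          gaussianDensity (h (z i ω + Multiset.replicate i b)) σ t := by
      intro b hb t
      rw [subsampledDensity_insert S w h σ hb (hS b hb)]
      simp_rw [Finset.mul_sum]
      rw [Finset.sum_comm (s := Finset.univ)]
      refine Finset.sum_congr rfl fun i hi => ?_
      have := hmarg i (Nat.lt_succ_iff.1 (Finset.mem_range.1 hi)) fun y =>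
        gaussianDensity (h (y + Multiset.replicate i b)) σ t
      rw [← Finset.mul_sum, this, Finset.mul_sum]
      exact Finset.sum_congr rfl fun ω _ => mul_left_comm _ _ _
    have hdist : ∀ b, (∀ y : Multiset A, Multiset.card y = q → (∀ c ∈ y, c ∈ insert b x) → y ∈ Y) →
        ∀ ω, ∀ i ≤ q, ‖h (z i ω + Multiset.replicate i b) - h (z 0 ω)‖ ≤
          i * l2Sensitivity Y h := by
      intro b hb ω i hi
      have := norm_sub_le_of_chain hbdd (fun i => z i ω + Multiset.replicate i b) (q := q) ?_ ?_ hi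
      · simpa using this
      · intro i hi
        obtain ⟨h1, h2⟩ := hz ω i hi
        refine hb _ (by simp [h1, hi]) fun c hc => ?_
        rcases Multiset.mem_add.1 hc with hc | hc
        · exact Finset.mem_insert_of_mem (h2 c hc)
        · exact Multiset.eq_of_mem_replicate hc ▸ Finset.mem_insert_self b x
      · intro i hi
        obtain ⟨c, hc⟩ := hchain ω i hi
        have := batchSubst_add_replicate (z (i + 1) ω) c b i
        rwa [← hc] at this
    -- The centre `h (z 0 ω)` contains neither `a` nor `a'`, so it serves both mixtures.
    exact hockeyStick_le_of_coupling hσ hpos q w hw hwq hα p hp0 hp1 (fun ω => h (z 0 ω))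
      (fun i ω => h (z i ω + Multiset.replicate i a))
      (fun i ω => h (z i ω + Multiset.replicate i a')) (hdist a hY) (hdist a' hY') _ _
      (hdens a ha) (hdens a' ha')

theorem sum_count_add_one_div {x : Finset A} (hx : x.Nonempty) {k : ℕ} {z : Multiset A}
    (hz : Multiset.card z = k) (hzx : ∀ b ∈ z, b ∈ x) :
    ∑ c ∈ x, ((z.count c + 1 : ℝ) / (x.card + k)) = 1 := by
  have hpos : 0 < x.card := Finset.card_pos.2 hx
  rw [← Finset.sum_div, Finset.sum_add_distrib, ← Nat.cast_sum, Multiset.sum_count_eq_card hzx, hz,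
    Finset.sum_const, nsmul_eq_mul, mul_one, add_comm, div_self (by positivity)]

end Subsampling

/-! ### The two subsampling schemes. -/

theorem mainTheorem9 {A : Type*} [DecidableEq A]
    -- dataset space, batch space, dataset size, batch size, output dimension
    (X : Set (Finset A)) (Y : Set (Multiset A)) (N q D : ℕ)
    -- every batch of size `q` that can be drawn from a dataset is in the batch space
    (hXY : ∀ x ∈ X, ∀ y : Multiset A, Multiset.card y = q → (∀ b ∈ y, b ∈ x) → y ∈ Y)
    (h : Multiset A → EuclideanSpace ℝ (Fin D)) (σ : ℝ) (hσ : 0 < σ)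
    (hbdd : BddAbove (substGaps Y h)) (hpos : 0 < l2Sensitivity Y h)
    (x x' : Finset A) (hx : x ∈ X) (hx' : x' ∈ X) (hxx' : DatasetSubst x x')
    (hcard : x.card = N) (hcard' : x'.card = N)
    -- for one-element datasets, the mixed batches have to be in the batch space too
    (hN : N = 1 → ∀ y : Multiset A, Multiset.card y = q → (∀ b ∈ y, b ∈ x ∪ x') → y ∈ Y)
    (α : ℝ) (hα : 0 ≤ α) :
    hockeyStick α (subsampledDensity q (iidPMF q) h σ x) (subsampledDensity q (iidPMF q) h σ x') ≤
        hockeyStick α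
          (gaussianMixture q (iidWeight N q) 1 (σ / l2Sensitivity Y h))
          (gaussianMixture q (iidWeight N q) (-1) (σ / l2Sensitivity Y h)) ∧
      hockeyStick α (subsampledDensity q (uniformMultisetPMF q) h σ x)
          (subsampledDensity q (uniformMultisetPMF q) h σ x') ≤
        hockeyStick α
          (gaussianMixture q (uniformMultisetWeight N q) 1 (σ / l2Sensitivity Y h))
          (gaussianMixture q (uniformMultisetWeight N q) (-1) (σ / l2Sensitivity Y h)) := by
  obtain ⟨a, hax, a', hax', rfl⟩ := hxx'
  obtain ⟨x₀, ha, rfl⟩ : ∃ x₀, a ∉ x₀ ∧ insert a x₀ = x :=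
    ⟨x.erase a, Finset.notMem_erase a x, Finset.insert_erase hax⟩
  rw [Finset.erase_insert ha] at hx' hcard' hN ⊢
  have ha' : a' ∉ x₀ := fun h => hax' (Finset.mem_insert_of_mem h)
  have hNc : x₀.card + 1 = N := by rw [← hcard, Finset.card_insert_of_notMem ha]
  have hins : ∀ b ∉ x₀, (insert b x₀).card = N := fun b hb => by
    rw [Finset.card_insert_of_notMem hb, hNc]
  have hempty : x₀ = ∅ → N = 1 := by rintro rfl; simpa using hNc.symm
  have hN0 : 0 < N := by omega
  have hY0 : x₀ = ∅ → ∀ y : Multiset A, Multiset.card y = q → (∀ b ∈ y, b = a ∨ b = a') →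
      y ∈ Y := by
    intro h0 y hy hb
    refine hN (hempty h0) y hy fun b hby => ?_
    rcases hb b hby with rfl | rfl <;> simp
  have hN1 : (1 : ℝ) ≤ N := by exact_mod_cast hN0
  have hiid : ∀ i, 0 ≤ iidWeight N q i := by
    intro i
    have : 0 ≤ 1 - 1 / (N : ℝ) := by
      rw [sub_nonneg, div_le_one (by positivity)]
      exact hN1
    unfold iidWeight
    positivity
  constructor
  · refine hockeyStick_subsampledDensity_le hσ hα Y h hbdd hpos iidPMF (iidWeight N q) hiid ?_ ha ha'
      (hXY _ hx) (hXY _ hx') hY0 ?_ ?_ ?_ (fun _ _ _ => 1 / (x₀.card : ℝ)) ?_ ?_ ?_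
    · simp only [iidWeight, Nat.choose_self, Nat.sub_self, pow_zero]
      positivity
    · intro b hb i hi z hz hzx
      rw [iidPMF_add_replicate hb hi hz hzx, hins b hb]
    · simp [iidPMF]
    · intro h0 i hi
      simp [iidWeight, hempty h0, Nat.sub_ne_zero_of_lt hi]
    · intro _ _ _
      positivity
    · intro hne k z _
      have : 0 < x₀.card := Finset.card_pos.2 hne
      left
      rw [Finset.sum_const, nsmul_eq_mul, mul_one_div_cancel (by positivity)]
    · exact fun _ k y hk hy => iidPMF_succ k y hk hy
  · refine hockeyStick_subsampledDensity_le hσ hα Y h hbdd hpos uniformMultisetPMF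
      (uniformMultisetWeight N q) ?_ ?_ ha ha'
      (hXY _ hx) (hXY _ hx') hY0 ?_ ?_ ?_
      (fun k z c => ((z.count c + 1 : ℝ) / (x₀.card + k))) ?_ ?_ ?_
    · intro i
      unfold uniformMultisetWeight
      positivity
    · simp only [uniformMultisetWeight, Nat.sub_self, Nat.multichoose_zero_right]
      have := multichoose_pos (k := q) hN0
      positivity
    · intro b hb i hi z hz hzx
      rw [uniformMultisetPMF_add_replicate hb hi hz hzx, hins b hb]
    · simp [uniformMultisetPMF, Nat.multichoose_zero_right]
    · intro h0 i hi
      obtain ⟨k, hk⟩ := Nat.exists_eq_succ_of_ne_zero (Nat.sub_ne_zero_of_lt hi)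
      simp [uniformMultisetWeight, hempty h0, hk, Nat.multichoose_zero_succ]
    · intro _ _ _
      positivity
    · intro hne k z hz
      by_cases hzx : ∀ b ∈ z, b ∈ x₀
      · exact Or.inl (sum_count_add_one_div hne hz hzx)
      · push Not at hzx
        exact Or.inr hzx
    · exact fun hne k y hk hy => uniformMultisetPMF_succ (Finset.card_pos.2 hne) k y hk hy
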